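/- **Setting.** Let $(S,+,\cdot,0,1)$ be a semiring with $1\neq 0$ that is (i) a *Conway semiring*: it carries an operation $*:S\to S$ with $(a+b)^*=a^*(ba^*)^*$ and $(ab)^*=1+a(ba)^*b$ for all $a,b$; (ii) *positive*: $x+y=0$ implies $x=y=0$; (iii) *refinement*: $x+y=z+w$ implies that there are $s,t,u,v$ with $s+t=x$, $s+u=z$, $u+v=y$, $t+v=w$. Let $T$ be a finite set (primitive tests) and $\mathrm{Act}$, $\mathrm{Out}$ sets (actions, return values). *Syntax.* Tests: $b,c::=\mathbb 0\mid\mathbb 1\mid t\in T\mid\bar b\mid b+c\mid bc$. Write $\equiv_{BA}$ for Boolean equivalence of tests and $b\le c$ for $b+c\equiv_{BA}c$; $\mathrm{At}$ is the set of atoms (minimal nonzero elements) of $\mathrm{BExp}/{\equiv_{BA}}$. Expressions $\mathrm{Exp}$: $e,f::=p\in\mathrm{Act}\mid b\mid e+_bf\mid e;f\mid e^{(b)}\mid v\in\mathrm{Out}\mid e\,{}_r\!\oplus_s f$ with $b$ a test and $r,s\in S$. Put $\odot r:=\mathbb 1\,{}_r\!\oplus_0\mathbb 0$. *Automata and bisimilarity.*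 Let $\mathcal M_\omega(X)$ be the set of finitely supported functions $X\to S$, $\delta_x$ the function that is $1$ at $x$ and $0$ elsewhere, and $\nu[A]=\sum_{x\in A}\nu(x)$. An automaton is a set $X$ with a map $\beta:X\to\mathcal M_\omega(2+\mathrm{Out}+\mathrm{Act}\times X)^{\mathrm{At}}$, where $2=\{\checkmark,\times\}$. A map $h:X\to Y$ is a homomorphism $(X,\beta)\to(Y,\gamma)$ if $\gamma(h(x))_\alpha(o)=\beta(x)_\alpha(o)$ for $o\in 2+\mathrm{Out}$ and $\gamma(h(x))_\alpha(p,y)=\beta(x)_\alpha[\{p\}\times h^{-1}(y)]$ for all $p,y$. A relation $R\subseteq X\times Y$ is a bisimulation if it carries an automaton structure for which both projections are homomorphisms. *Semantics.* The automaton $(\mathrm{Exp},\partial)$ is defined by: $\partial(b)_\alpha=\delta_\checkmark$ if $\alpha\le b$ and $\delta_\times$ if $\alpha\le\bar b$; $\partial(v)_\alpha=\delta_v$; $\partial(p)_\alpha=\delta_{(p,\mathbb 1)}$; $\partial(e+_bf)_\alpha=\partial(e)_\alpha$ if $\alpha\le b$ and $\partial(f)_\alpha$ if $\alpha\le\bar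 b$; $\partial(e\,{}_r\!\oplus_sf)_\alpha=r\,\partial(e)_\alpha+s\,\partial(f)_\alpha$; $\partial(e;f)_\alpha=\sum_x\partial(e)_\alpha(x)\,c(x)$ with $c(\checkmark)=\partial(f)_\alpha$, $c(x)=\delta_x$ for $x\in\{\times\}\cup\mathrm{Out}$, $c(p,e')=\delta_{(p,e';f)}$; and, if $\alpha\le\bar b$, $\partial(e^{(b)})_\alpha=\delta_\checkmark$, while if $\alpha\le b$, with $w=\partial(e)_\alpha(\checkmark)^*$, $\partial(e^{(b)})_\alpha$ takes the value $w\,\partial(e)_\alpha(x)$ at $x\in\{\times\}\cup\mathrm{Out}$, the value $w\,\partial(e)_\alpha(p,e')$ at $(p,e';e^{(b)})$, and $0$ elsewhere. Write $e\sim f$ if $(e,f)$ lies in some bisimulation on $(\mathrm{Exp},\partial)$. *Axioms.* Define $E(e)_\alpha\in S$ by $E(p)_\alpha=E(v)_\alpha=0$; $E(b)_\alpha=1$ if $\alpha\le b$ and $0$ if $\alpha\le\bar b$; $E(e\,{}_r\!\oplus_sf)_\alpha=rE(e)_\alpha+sE(f)_\alpha$; $E(e+_bf)_\alpha=E(e)_\alpha$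 if $\alpha\le b$ and $E(f)_\alpha$ if $\alpha\le\bar b$; $E(e;f)_\alpha=E(e)_\alpha E(f)_\alpha$; $E(e^{(b)})_\alpha=E(\bar b)_\alpha$. Let $\equiv$ be the smallest congruence on $\mathrm{Exp}$ (tests, as assertions and as guards, being taken up to $\equiv_{BA}$) such that for all $e,f,g\in\mathrm{Exp}$, tests $b,c$, $v\in\mathrm{Out}$, $r,s,t,u\in S$: - $e+_be\equiv e$; $\ e+_bf\equiv b;e+_bf$; $\ e+_bf\equiv f+_{\bar b}e$; $\ (e+_bf)+_cg\equiv e+_{bc}(f+_cg)$; - $e\,{}_r\!\oplus_s(f+_bg)\equiv(e\,{}_r\!\oplus_sf)+_b(e\,{}_r\!\oplus_sg)$; $\ e\,{}_r\!\oplus_s(f\,{}_t\!\oplus_ug)\equiv e\,{}_r\!\oplus_1(f\,{}_{st}\!\oplus_{su}g)$; $\ b;(e\,{}_r\!\oplus_sf)\equiv b;(b;e\,{}_r\!\oplus_s\,b;f)$; - $\mathbb 1;e\equiv e\equiv e;\mathbb 1$; $\ (e;f);g\equiv e;(f;g)$; $\ \mathbb 0;e\equiv\mathbb 0$; $\ (e\,{}_r\!\oplus_sf);g\equiv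 e;g\,{}_r\!\oplus_s\,f;g$; $\ (e+_bf);g\equiv e;g+_bf;g$; $\ v;e\equiv v$; $\ b;c\equiv bc$; - $e^{(b)}\equiv e;e^{(b)}+_b\mathbb 1$; $\ $ if $e\equiv(f\,{}_r\!\oplus_s\mathbb 1)+_cg$ then $c;e^{(b)}\equiv c;\big((\odot(s^*r);f;e^{(b)})+_b\mathbb 1\big)$; - $\odot1\equiv\mathbb 1$; $\ \odot0;e\equiv\odot0$; - $e\,{}_r\!\oplus_se\equiv\odot(r+s);e$; $\ e\,{}_r\!\oplus_sf\equiv f\,{}_s\!\oplus_re$; $\ e\,{}_r\!\oplus_s(f\,{}_t\!\oplus_ug)\equiv(e\,{}_r\!\oplus_{st}f)\,{}_1\!\oplus_{su}g$; $\ e\,{}_{ru}\!\oplus_sf\equiv(\odot u;e)\,{}_r\!\oplus_sf$; - if $g\equiv e;g+_bf$ and $E(e)_\alpha=0$ for all $\alpha\in\mathrm{At}$, then $g\equiv e^{(b)};f$. **Soundness.** For all $e,f\in\mathrm{Exp}$, $e\equiv f$ implies $e\sim f$. -/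

import Mathlib

noncomputable section

namespace WGKAT

open scoped Computability

/-! ### Weights -/

/-- A Conway semiring: a semiring with a star operation `a∗` satisfying the two Conway identities. -/
class ConwaySemiring (S : Type*) extends Semiring S, KStar S where
  star_add : ∀ a b : S, (a + b)∗ = a∗ * (b * a∗)∗
  star_mul : ∀ a b : S, (a * b)∗ = 1 + a * (b * a)∗ * b

/-- A commutative monoid is positive (conical) if only `0 + 0` sums to `0`. -/
def IsPositive (M : Type*) [AddCommMonoid M] : Prop :=
  ∀ x y : M, x + y = 0 → x = 0 ∧ y = 0

/-- A commutative monoid is a refinement monoid if any two decompositions of the same element into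
two summands have a common refinement. -/
def IsRefinement (M : Type*) [AddCommMonoid M] : Prop :=
  ∀ x y z w : M, x + y = z + w →
    ∃ s t u v : M, s + t = x ∧ s + u = z ∧ u + v = y ∧ t + v = w

/-- Finitely supported weightings on `X` with values in `S`. -/
abbrev Weighting (S X : Type*) [Semiring S] := X →₀ S

/-- The Dirac weighting. -/
def dirac {S X : Type*} [Semiring S] (x : X) : Weighting S X := Finsupp.single x 1

/-- The linearization of `h`: `lin h φ = ∑ x, φ x • h x`. -/
def lin {S X Y : Type*} [Semiring S] (h : X → Weighting S Y) (φ : Weighting S X) :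
    Weighting S Y :=
  φ.sum fun x r => r • h x

open Classical in
/-- The total weight of a set `A`: the (finite) sum of the weights of the elements of `A`. -/
def weight {S X : Type*} [Semiring S] (ν : Weighting S X) (A : Set X) : S :=
  ∑ x ∈ ν.support with x ∈ A, ν x

/-! ### Tests and atoms -/

/-- Boolean expressions over the primitive tests `T`. -/
inductive BExp (T : Type*) where
  | zero : BExp T
  | one : BExp T
  | prim (t : T) : BExp T
  | not (b : BExp T) : BExp T
  | or (b c : BExp T) : BExp T
  | and (b c : BExp T) : BExp T

/-- The truth value of a Boolean expression under a truth assignment. -/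
def BExp.eval {T : Type*} (v : T → Bool) : BExp T → Bool
  | .zero => false
  | .one => true
  | .prim t => v t
  | .not b => !(b.eval v)
  | .or b c => b.eval v || c.eval v
  | .and b c => b.eval v && c.eval v

/-- Boolean equivalence of tests. -/
def BAEquiv {T : Type*} (b c : BExp T) : Prop := ∀ v : T → Bool, b.eval v = c.eval v

instance baSetoid (T : Type*) : Setoid (BExp T) where
  r := BAEquiv
  iseqv := ⟨fun _ _ => rfl, fun h v => (h v).symm, fun h k v => (h v).trans (k v)⟩

/-- Entailment of tests: `b ≤ c` if and only if `b + c` is Boolean equivalent to `c`. -/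
def BALe {T : Type*} (b c : BExp T) : Prop := BAEquiv (.or b c) c

theorem baLe_iff {T : Type*} (b c : BExp T) :
    BALe b c ↔ ∀ v : T → Bool, b.eval v = true → c.eval v = true := by
  refine forall_congr' fun v => ?_
  simp only [BExp.eval]
  cases b.eval v <;> cases c.eval v <;> simp

/-- The quotient of the tests by Boolean equivalence, that is, the free Boolean algebra on `T`. -/
def BQuot (T : Type*) : Type _ := Quotient (baSetoid T)

/-- The class of a test. -/
def BQuot.mk {T : Type*} (b : BExp T) : BQuot T := Quotient.mk (baSetoid T) b

instance (T : Type*) : PartialOrder (BQuot T) where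
  le := Quotient.lift₂ BALe (by
    intro a b a' b' h h'
    refine propext ?_
    rw [baLe_iff, baLe_iff]
    refine forall_congr' fun v => ?_
    rw [h v, h' v])
  le_refl := by
    rintro ⟨a⟩
    exact (baLe_iff a a).2 fun _ h => h
  le_trans := by
    rintro ⟨a⟩ ⟨b⟩ ⟨c⟩ h k
    exact (baLe_iff a c).2 fun v ha => (baLe_iff b c).1 k v ((baLe_iff a b).1 h v ha)
  le_antisymm := by
    rintro ⟨a⟩ ⟨b⟩ h k
    refine Quotient.sound fun v => ?_
    exact Bool.eq_iff_iff.2 ⟨(baLe_iff a b).1 h v, (baLe_iff b a).1 k v⟩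

instance (T : Type*) : OrderBot (BQuot T) where
  bot := BQuot.mk .zero
  bot_le := by
    rintro ⟨a⟩
    exact (baLe_iff .zero a).2 fun v h => by simp [BExp.eval] at h

theorem BQuot.mk_le_mk {T : Type*} (b c : BExp T) : BQuot.mk b ≤ BQuot.mk c ↔ BALe b c := Iff.rfl

theorem BQuot.bot_def (T : Type*) : (⊥ : BQuot T) = BQuot.mk .zero := rfl

/-- The atoms: the minimal nonzero elements of the quotient. -/
def Atom (T : Type*) : Type _ := {a : BQuot T // IsAtom a}

/-- The atom `α` entails the test `b`. -/
def Atom.Entails {T : Type*} (α : Atom T) (b : BExp T) : Prop := α.1 ≤ BQuot.mk b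

/-- An atom entails `b̄` exactly if it does not entail `b`; so a case distinction between the two may
be written as an `if α.Entails b then _ else _`. -/
theorem Atom.entails_not_iff {T : Type*} (α : Atom T) (b : BExp T) :
    α.Entails (.not b) ↔ ¬ α.Entails b := by
  obtain ⟨⟨a⟩, ha⟩ := α
  have hle (c : BExp T) : Atom.Entails ⟨Quot.mk _ a, ha⟩ c ↔
      ∀ v : T → Bool, a.eval v = true → c.eval v = true := baLe_iff a c
  rw [hle, hle]
  constructor
  · intro h k
    refine ha.1 (le_bot_iff.1 ((baLe_iff a .zero).2 fun v hv => ?_))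
    have h1 := h v hv
    have h2 := k v hv
    simp [BExp.eval, h2] at h1
  · intro h v hv
    have hlt : BQuot.mk (.and a b) < Quot.mk _ a := by
      refine lt_of_le_of_ne ((baLe_iff (.and a b) a).2 fun w hw => ?_) fun heq => h fun w hw => ?_
      · simp only [BExp.eval, Bool.and_eq_true] at hw
        exact hw.1
      · have := (Quotient.exact heq : BAEquiv (.and a b) a) w
        simp only [BExp.eval, hw, Bool.true_and] at this
        exact this
    have := (Quotient.exact (ha.2 _ hlt) : BAEquiv (.and a b) .zero) v
    simp only [BExp.eval, hv, Bool.true_and] at this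
    simp [BExp.eval, this]

/-! ### Expressions -/

/-- Expressions, over primitive tests `T`, actions `Act`, return values `Out` and weights `S`. -/
inductive Exp (T Act Out S : Type*) where
  /-- do `p` -/
  | act (p : Act) : Exp T Act Out S
  /-- assert `b` -/
  | test (b : BExp T) : Exp T Act Out S
  /-- `e +_b f`: if `b` do `e` else do `f` -/
  | ite (b : BExp T) (e f : Exp T Act Out S) : Exp T Act Out S
  /-- `e ; f` -/
  | seq (e f : Exp T Act Out S) : Exp T Act Out S
  /-- `e^(b)`: while `b` do `e` -/
  | loop (b : BExp T) (e : Exp T Act Out S) : Exp T Act Out S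
  /-- return `v` -/
  | out (v : Out) : Exp T Act Out S
  /-- weighted choice: `e` with weight `r` and `f` with weight `s` -/
  | choice (r s : S) (e f : Exp T Act Out S) : Exp T Act Out S

/-- The test `1` as an expression. -/
def Exp.one {T Act Out S : Type*} : Exp T Act Out S := .test .one

/-- The test `0` as an expression. -/
def Exp.zero {T Act Out S : Type*} : Exp T Act Out S := .test .zero

/-- Scaling by `r`: the weighted choice of `1` with weight `r` and `0` with weight `0`. -/
def Exp.scale {T Act Out S : Type*} [Semiring S] (r : S) : Exp T Act Out S :=
  .choice r 0 .one .zero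

/-! ### Automata, homomorphisms, bisimulations -/

/-- The set `2 + Out + Act × X` with `2 = {accept, reject}`. -/
inductive Obs (Act Out X : Type*) where
  | accept : Obs Act Out X
  | reject : Obs Act Out X
  | out (v : Out) : Obs Act Out X
  | step (p : Act) (x : X) : Obs Act Out X

/-- Transition functions of automata with set of states `X`. -/
abbrev Trans (T Act Out S X : Type*) [Semiring S] :=
  X → Atom T → Weighting S (Obs Act Out X)

/-- Homomorphisms of automata. -/
structure IsHom {T Act Out S X Y : Type*} [Semiring S]
    (β : Trans T Act Out S X) (γ : Trans T Act Out S Y) (f : X → Y) : Prop where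
  accept : ∀ x α, γ (f x) α .accept = β x α .accept
  reject : ∀ x α, γ (f x) α .reject = β x α .reject
  out : ∀ x α v, γ (f x) α (.out v) = β x α (.out v)
  step : ∀ x α p y,
    γ (f x) α (.step p y) = weight (β x α) {o | ∃ x', f x' = y ∧ o = .step p x'}

/-- A relation is a bisimulation if it carries a transition function that makes both projections
homomorphisms. -/
def IsBisimulation {T Act Out S X Y : Type*} [Semiring S]
    (β : Trans T Act Out S X) (γ : Trans T Act Out S Y) (R : Set (X × Y)) : Prop :=
  ∃ ρ : Trans T Act Out S R,
    IsHom ρ β (fun z => z.1.1) ∧ IsHom ρ γ (fun z => z.1.2)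

/-- Two states are bisimilar if some bisimulation relates them. -/
def Bisimilar {T Act Out S X Y : Type*} [Semiring S]
    (β : Trans T Act Out S X) (γ : Trans T Act Out S Y) (x : X) (y : Y) : Prop :=
  ∃ R : Set (X × Y), IsBisimulation β γ R ∧ (x, y) ∈ R

/-! ### Operational semantics -/

/-- The continuation of an observation by `f`, where `df` is the derivative of `f`. -/
def seqCont {T Act Out S : Type*} [Semiring S] (f : Exp T Act Out S)
    (df : Weighting S (Obs Act Out (Exp T Act Out S))) :
    Obs Act Out (Exp T Act Out S) → Weighting S (Obs Act Out (Exp T Act Out S))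
  | .accept => df
  | .reject => dirac .reject
  | .out v => dirac (.out v)
  | .step p e => dirac (.step p (.seq e f))

/-- The derivative `∂(e)_α`. For a loop `e^(b)` whose guard holds, the non-accepting part of the
derivative of `e`, with every next state `e'` replaced by `e' ; e^(b)`, is scaled by the star of the
weight with which `e` accepts; the values of this weighting are listed in the lemmas below. -/
def deriv {T Act Out S : Type*} [ConwaySemiring S] :
    Exp T Act Out S → Atom T → Weighting S (Obs Act Out (Exp T Act Out S))
  | .act p, _ => dirac (.step p .one)
  | .test b, α =>
    open Classical in
    if α.Entails b then dirac .accept else dirac .reject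
  | .ite b e f, α =>
    open Classical in
    if α.Entails b then deriv e α else deriv f α
  | .seq e f, α => lin (seqCont f (deriv f α)) (deriv e α)
  | .loop b e, α =>
    open Classical in
    if α.Entails b then (deriv e α .accept)∗ • lin (seqCont (.loop b e) 0) (deriv e α)
    else dirac .accept
  | .out v, _ => dirac (.out v)
  | .choice r s e f, α => r • deriv e α + s • deriv f α

section LoopValues

variable {T Act Out S : Type*} [ConwaySemiring S]

theorem lin_seqCont_zero_apply (f : Exp T Act Out S)
    (φ : Weighting S (Obs Act Out (Exp T Act Out S))) (x y : Obs Act Out (Exp T Act Out S))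
    (h : ∀ z, seqCont f 0 z y = open Classical in if z = x then (1 : S) else 0) :
    lin (seqCont f 0) φ y = φ x := by
  classical
  rw [lin, Finsupp.sum, Finsupp.finsetSum_apply]
  simp only [Finsupp.smul_apply, h, smul_eq_mul, mul_ite, mul_one, mul_zero]
  rw [Finset.sum_ite_eq' φ.support x]
  simp +contextual [eq_comm]

theorem lin_seqCont_zero_apply_zero (f : Exp T Act Out S)
    (φ : Weighting S (Obs Act Out (Exp T Act Out S))) (y : Obs Act Out (Exp T Act Out S))
    (h : ∀ z, seqCont f (0 : Weighting S (Obs Act Out (Exp T Act Out S))) z y = 0) :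
    lin (seqCont f 0) φ y = 0 := by
  rw [lin, Finsupp.sum, Finsupp.finsetSum_apply]
  simp [h]

theorem deriv_loop_not (b : BExp T) (e : Exp T Act Out S) (α : Atom T) (h : α.Entails (.not b)) :
    deriv (.loop b e) α = dirac .accept := by
  rw [deriv, if_neg ((α.entails_not_iff b).1 h)]

theorem deriv_loop_accept (b : BExp T) (e : Exp T Act Out S) (α : Atom T) (h : α.Entails b) :
    deriv (.loop b e) α .accept = 0 := by
  rw [deriv, if_pos h, Finsupp.smul_apply, lin_seqCont_zero_apply_zero, smul_zero]
  rintro (_ | _ | _ | _) <;> simp [seqCont, dirac]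

theorem deriv_loop_reject (b : BExp T) (e : Exp T Act Out S) (α : Atom T) (h : α.Entails b) :
    deriv (.loop b e) α .reject = (deriv e α .accept)∗ * deriv e α .reject := by
  classical
  rw [deriv, if_pos h, Finsupp.smul_apply, lin_seqCont_zero_apply _ _ .reject, smul_eq_mul]
  rintro (_ | _ | _ | _) <;> simp [seqCont, dirac]

theorem deriv_loop_out (b : BExp T) (e : Exp T Act Out S) (α : Atom T) (h : α.Entails b)
    (v : Out) :
    deriv (.loop b e) α (.out v) = (deriv e α .accept)∗ * deriv e α (.out v) := by
  classical
  rw [deriv, if_pos h, Finsupp.smul_apply, lin_seqCont_zero_apply _ _ (.out v), smul_eq_mul]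
  rintro (_ | _ | _ | _) <;> simp [seqCont, dirac, Finsupp.single_apply]

theorem deriv_loop_step (b : BExp T) (e : Exp T Act Out S) (α : Atom T) (h : α.Entails b)
    (p : Act) (e' : Exp T Act Out S) :
    deriv (.loop b e) α (.step p (.seq e' (.loop b e))) =
      (deriv e α .accept)∗ * deriv e α (.step p e') := by
  classical
  rw [deriv, if_pos h, Finsupp.smul_apply, lin_seqCont_zero_apply _ _ (.step p e'), smul_eq_mul]
  rintro (_ | _ | _ | _) <;> simp [seqCont, dirac, Finsupp.single_apply]

theorem deriv_loop_step_other (b : BExp T) (e : Exp T Act Out S) (α : Atom T) (h : α.Entails b)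
    (p : Act) (g : Exp T Act Out S) (hg : ∀ e', g ≠ .seq e' (.loop b e)) :
    deriv (.loop b e) α (.step p g) = 0 := by
  rw [deriv, if_pos h, Finsupp.smul_apply, lin_seqCont_zero_apply_zero, smul_zero]
  rintro (_ | _ | _ | ⟨q, e'⟩)
  · simp [seqCont]
  · simp [seqCont, dirac]
  · simp [seqCont, dirac]
  · simp [seqCont, dirac, (hg e').symm]

end LoopValues

/-! ### The axiomatization -/

/-- The weight `E(e)_α` of immediate acceptance. -/
def E {T Act Out S : Type*} [Semiring S] : Exp T Act Out S → Atom T → S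
  | .act _, _ => 0
  | .out _, _ => 0
  | .test b, α =>
    open Classical in
    if α.Entails b then 1 else 0
  | .choice r s e f, α => r * E e α + s * E f α
  | .ite b e f, α =>
    open Classical in
    if α.Entails b then E e α else E f α
  | .seq e f, α => E e α * E f α
  | .loop b _, α =>
    open Classical in
    if α.Entails (.not b) then 1 else 0

/-- Provable equivalence: the smallest congruence satisfying the axioms. Tests are taken up to
Boolean equivalence, both as assertions (`ba`) and as guards (`congr_ite`, `congr_loop`). -/
inductive Provable {T Act Out S : Type*} [ConwaySemiring S] :
    Exp T Act Out S → Exp T Act Out S → Prop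
  | refl (e) : Provable e e
  | symm {e f} : Provable e f → Provable f e
  | trans {e f g} : Provable e f → Provable f g → Provable e g
  | congr_ite {b c e e' f f'} : BAEquiv b c → Provable e e' → Provable f f' →
      Provable (.ite b e f) (.ite c e' f')
  | congr_seq {e e' f f'} : Provable e e' → Provable f f' → Provable (.seq e f) (.seq e' f')
  | congr_loop {b c e e'} : BAEquiv b c → Provable e e' → Provable (.loop b e) (.loop c e')
  | congr_choice {e e' f f'} (r s : S) : Provable e e' → Provable f f' →
      Provable (.choice r s e f) (.choice r s e' f')
  | ba {b c} : BAEquiv b c → Provable (.test b) (.test c)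
  -- guarded choice
  | G1 (b e) : Provable (.ite b e e) e
  | G2 (b e f) : Provable (.ite b e f) (.ite b (.seq (.test b) e) f)
  | G3 (b e f) : Provable (.ite b e f) (.ite (.not b) f e)
  | G4 (b c e f g) : Provable (.ite c (.ite b e f) g) (.ite (.and b c) e (.ite c f g))
  -- distributivity
  | D1 (r s : S) (b e f g) :
      Provable (.choice r s e (.ite b f g)) (.ite b (.choice r s e f) (.choice r s e g))
  | D2 (r s t u : S) (e f g) :
      Provable (.choice r s e (.choice t u f g)) (.choice r 1 e (.choice (s * t) (s * u) f g))
  | D3 (r s : S) (b e f) :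
      Provable (.seq (.test b) (.choice r s e f))
        (.seq (.test b) (.choice r s (.seq (.test b) e) (.seq (.test b) f)))
  -- sequencing
  | S1_left (e) : Provable (.seq .one e) e
  | S1_right (e) : Provable e (.seq e .one)
  | S2 (e f g) : Provable (.seq (.seq e f) g) (.seq e (.seq f g))
  | S3 (e) : Provable (.seq .zero e) .zero
  | S4 (r s : S) (e f g) :
      Provable (.seq (.choice r s e f) g) (.choice r s (.seq e g) (.seq f g))
  | S5 (b e f g) : Provable (.seq (.ite b e f) g) (.ite b (.seq e g) (.seq f g))
  | S6 (v e) : Provable (.seq (.out v) e) (.out v)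
  | S7 (b c) : Provable (.seq (.test b) (.test c)) (.test (.and b c))
  -- loops
  | L1 (b e) : Provable (.loop b e) (.ite b (.seq e (.loop b e)) .one)
  | L2 (r s : S) (b c e f g) : Provable e (.ite c (.choice r s f .one) g) →
      Provable (.seq (.test c) (.loop b e))
        (.seq (.test c) (.ite b (.seq (.scale (s∗ * r)) (.seq f (.loop b e))) .one))
  -- scaling
  | C1 : Provable (.scale 1) .one
  | C2 (e) : Provable (.seq (.scale 0) e) (.scale 0)
  -- weighted choice
  | W1 (r s : S) (e) : Provable (.choice r s e e) (.seq (.scale (r + s)) e)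
  | W2 (r s : S) (e f) : Provable (.choice r s e f) (.choice s r f e)
  | W3 (r s t u : S) (e f g) :
      Provable (.choice r s e (.choice t u f g)) (.choice 1 (s * u) (.choice r (s * t) e f) g)
  | W4 (r s u : S) (e f) :
      Provable (.choice (r * u) s e f) (.choice r s (.seq (.scale u) e) f)
  -- fixpoint rule
  | F1 (b e f g) : Provable g (.ite b (.seq e g) f) → (∀ α : Atom T, E e α = 0) →
      Provable g (.seq (.loop b e) f)

end WGKAT

end

/-! Provable equivalence is itself a bisimulation: it is the kernel of the projection `ExpQuot.mk`
onto classes. Two independent facts show this.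

`Provable.quotDeriv_eq`: provably equivalent expressions have equal derivatives once successor
states are read modulo provable equivalence. This is an induction on derivations. The loop axioms
come down to the star laws `star_eq_one_add` and `star_add_eq`. The fixpoint rule needs no
uniqueness argument: if `e` never accepts immediately, then under the guard the derivatives of `e;g`
and `e^(b);f` differ only in the successors `e';g` and `(e';e^(b));f`, and these are identified by
the conclusion of the rule itself.

`isBisimulation_ker`: a map modulo which related states have equal derivatives has a bisimulation as
kernel. Equality of pushforwards must be turned into a weighting on pairs with prescribed marginals.
`IsRefinement.exists_coupling` builds it: refinement cuts one weighting into pieces matching the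
other, and positivity keeps each piece inside its fibre. -/

namespace WGKAT

open scoped Computability

/-! ### Couplings of weightings over a positive refinement monoid -/

section Coupling

variable {M A B : Type*} [AddCommMonoid M]

/-- The value `ψ a` is one summand of the pushforward at `q a`, and positivity forbids it to cancel
against the others. -/
theorem IsPositive.mapDomain_apply_ne_zero (hpos : IsPositive M) (q : A → B) (ψ : A →₀ M) {a : A}
    (ha : ψ a ≠ 0) : ψ.mapDomain q (q a) ≠ 0 := by
  intro h
  rw [← Finsupp.single_add_erase a ψ, Finsupp.mapDomain_add, Finsupp.mapDomain_single,
    Finsupp.add_apply, Finsupp.single_eq_same] at h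
  exact ha (hpos _ _ h).1

theorem IsPositive.finsupp (hpos : IsPositive M) : IsPositive (A →₀ M) := by
  intro x y h
  have h' (a : A) : x a = 0 ∧ y a = 0 := hpos _ _ (by rw [← Finsupp.add_apply, h]; rfl)
  exact ⟨Finsupp.ext fun a => (h' a).1, Finsupp.ext fun a => (h' a).2⟩

theorem IsPositive.eq_single (hpos : IsPositive M) {x y : A →₀ M} {a : A} {r : M}
    (h : x + y = Finsupp.single a r) : x = Finsupp.single a (x a) := by
  classical
  ext b
  by_cases hb : a = b
  · subst hb; simp
  · have hxy : x b + y b = 0 := by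
      rw [← Finsupp.add_apply, h, Finsupp.single_apply, if_neg hb]
    rw [(hpos _ _ hxy).1, Finsupp.single_apply, if_neg hb]

/-- Refinements are chosen pointwise. By positivity the pieces of `x a` and `y a` vanish wherever
these do, so the chosen functions are finitely supported. -/
theorem IsRefinement.finsupp (href : IsRefinement M) (hpos : IsPositive M) :
    IsRefinement (A →₀ M) := by
  classical
  intro x y z w h
  have h' (a : A) : x a + y a = z a + w a := DFunLike.congr_fun h a
  choose s t u v hst hsu huv htv using fun a => href _ _ _ _ (h' a)
  have hx (a : A) (ha : a ∉ x.support) : s a = 0 ∧ t a = 0 :=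
    hpos _ _ ((hst a).trans (Finsupp.notMem_support_iff.1 ha))
  have hy (a : A) (ha : a ∉ y.support) : u a = 0 ∧ v a = 0 :=
    hpos _ _ ((huv a).trans (Finsupp.notMem_support_iff.1 ha))
  refine ⟨Finsupp.onFinset x.support s fun a => ?_, Finsupp.onFinset x.support t fun a => ?_,
    Finsupp.onFinset y.support u fun a => ?_, Finsupp.onFinset y.support v fun a => ?_,
    Finsupp.ext hst, Finsupp.ext hsu, Finsupp.ext huv, Finsupp.ext htv⟩
  · exact not_imp_comm.1 fun ha => (hx a ha).1
  · exact not_imp_comm.1 fun ha => (hx a ha).2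
  · exact not_imp_comm.1 fun ha => (hy a ha).1
  · exact not_imp_comm.1 fun ha => (hy a ha).2

/-- A decomposition of a pushforward lifts to a decomposition of the original weighting. -/
theorem IsRefinement.exists_add_of_mapDomain_eq_add (href : IsRefinement M) (hpos : IsPositive M)
    (q : A → B) (ψ : A →₀ M) : ∀ μ₁ μ₂ : B →₀ M, ψ.mapDomain q = μ₁ + μ₂ →
      ∃ ψ₁ ψ₂ : A →₀ M, ψ = ψ₁ + ψ₂ ∧ ψ₁.mapDomain q = μ₁ ∧ ψ₂.mapDomain q = μ₂ := by
  induction ψ using Finsupp.induction with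
  | zero =>
    intro μ₁ μ₂ h
    rw [Finsupp.mapDomain_zero] at h
    obtain ⟨rfl, rfl⟩ := hpos.finsupp _ _ h.symm
    exact ⟨0, 0, by simp⟩
  | single_add a r ψ _ _ ih =>
    intro μ₁ μ₂ h
    rw [Finsupp.mapDomain_add, Finsupp.mapDomain_single] at h
    -- Here `s` and `t` split the point mass at `q a`, so by positivity they are concentrated there
    -- and lift to point masses at `a`; `u` and `v` split the rest and lift by induction.
    obtain ⟨s, t, u, v, hst, hsu, huv, htv⟩ := href.finsupp hpos _ _ _ _ h
    obtain ⟨ψ₁, ψ₂, rfl, h₁, h₂⟩ := ih u v huv.symm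
    have hs := hpos.eq_single hst
    have ht := hpos.eq_single ((add_comm t s).trans hst)
    have hr : s (q a) + t (q a) = r := by
      rw [← Finsupp.add_apply, hst, Finsupp.single_eq_same]
    refine ⟨Finsupp.single a (s (q a)) + ψ₁, Finsupp.single a (t (q a)) + ψ₂, ?_, ?_, ?_⟩
    · rw [← hr, Finsupp.single_add]; abel
    · rw [Finsupp.mapDomain_add, Finsupp.mapDomain_single, ← hs, h₁, hsu]
    · rw [Finsupp.mapDomain_add, Finsupp.mapDomain_single, ← ht, h₂, htv]

/-- Two weightings with the same pushforward along `q` have a coupling supported on the kernel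
of `q`. -/
theorem IsRefinement.exists_coupling (href : IsRefinement M) (hpos : IsPositive M)
    (q : A → B) (φ : A →₀ M) : ∀ ψ : A →₀ M, φ.mapDomain q = ψ.mapDomain q →
      ∃ χ : A × A →₀ M, χ.mapDomain Prod.fst = φ ∧ χ.mapDomain Prod.snd = ψ ∧
        ∀ z, χ z ≠ 0 → q z.1 = q z.2 := by
  classical
  induction φ using Finsupp.induction with
  | zero =>
    intro ψ h
    refine ⟨0, Finsupp.mapDomain_zero, ?_, by simp⟩
    rw [Finsupp.mapDomain_zero] at h ⊢
    ext a
    by_contra ha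
    exact hpos.mapDomain_apply_ne_zero q ψ (Ne.symm ha) (by rw [← h]; rfl)
  | single_add a r φ _ _ ih =>
    intro ψ h
    rw [Finsupp.mapDomain_add, Finsupp.mapDomain_single] at h
    -- Cut from `ψ` a piece `ψ₁` lying over the point mass at `q a`. It is coupled with `single a r`
    -- by pairing each of its points with `a`; induction couples the rest.
    obtain ⟨ψ₁, ψ₂, rfl, h₁, h₂⟩ := href.exists_add_of_mapDomain_eq_add hpos q ψ _ _ h.symm
    obtain ⟨χ, hφ, hψ, hχ⟩ := ih ψ₂ h₂.symm
    refine ⟨ψ₁.mapDomain (fun b => (a, b)) + χ, ?_, ?_, ?_⟩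
    · rw [Finsupp.mapDomain_add, hφ, ← Finsupp.mapDomain_comp]
      -- Pushing forward along a constant map shows that `ψ₁` has total weight `r`.
      have := congrArg (Finsupp.mapDomain fun _ => a) h₁
      rw [← Finsupp.mapDomain_comp, Finsupp.mapDomain_single] at this
      exact congrArg (· + φ) this
    · rw [Finsupp.mapDomain_add, hψ, ← Finsupp.mapDomain_comp]
      exact congrArg (· + ψ₂) Finsupp.mapDomain_id
    · intro z hz
      by_cases hz' : χ z = 0
      · rw [Finsupp.add_apply, hz', add_zero, ← Finsupp.mem_support_iff] at hz
        obtain ⟨b, hb, rfl⟩ := Finset.mem_image.1 (Finsupp.mapDomain_support hz)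
        have hne := hpos.mapDomain_apply_ne_zero q ψ₁ (Finsupp.mem_support_iff.1 hb)
        rw [h₁] at hne
        by_contra hab
        exact hne (by rw [Finsupp.single_apply, if_neg hab])
      · exact hχ z hz'

end Coupling

/-! ### Automata homomorphisms as pushforwards -/

section Hom

variable {T Act Out S X Y : Type*}

/-- The action of a map of states on observations. -/
def Obs.map (f : X → Y) : Obs Act Out X → Obs Act Out Y
  | .accept => .accept
  | .reject => .reject
  | .out v => .out v
  | .step p x => .step p (f x)

/-- Homomorphisms are defined through weights of fibres; this lets them be handled as equations
between pushforwards. -/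
theorem mapDomain_apply_eq_weight [Semiring S] (g : X → Y) (ν : Weighting S X) (y : Y) :
    ν.mapDomain g y = weight ν {x | g x = y} := by
  classical
  rw [weight, Finsupp.mapDomain, Finsupp.sum, Finsupp.finsetSum_apply, Finset.sum_filter]
  exact Finset.sum_congr rfl fun x _ => by simp [Finsupp.single_apply]

theorem weight_singleton [Semiring S] (ν : Weighting S X) (x : X) : weight ν {x} = ν x := by
  rw [← Finsupp.mapDomain_id (v := ν), mapDomain_apply_eq_weight, Finsupp.mapDomain_id]
  rfl

theorem mapDomain_obsMap_accept [Semiring S] (f : X → Y) (ν : Weighting S (Obs Act Out X)) :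
    ν.mapDomain (Obs.map f) .accept = ν .accept := by
  rw [mapDomain_apply_eq_weight, ← weight_singleton]
  congr 1
  ext (_ | _ | _ | _) <;> simp [Obs.map]

theorem mapDomain_obsMap_reject [Semiring S] (f : X → Y) (ν : Weighting S (Obs Act Out X)) :
    ν.mapDomain (Obs.map f) .reject = ν .reject := by
  rw [mapDomain_apply_eq_weight, ← weight_singleton]
  congr 1
  ext (_ | _ | _ | _) <;> simp [Obs.map]

theorem mapDomain_obsMap_out [Semiring S] (f : X → Y) (ν : Weighting S (Obs Act Out X)) (v : Out) :
    ν.mapDomain (Obs.map f) (.out v) = ν (.out v) := by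
  rw [mapDomain_apply_eq_weight, ← weight_singleton]
  congr 1
  ext (_ | _ | _ | _) <;> simp [Obs.map]

theorem mapDomain_obsMap_step [Semiring S] (f : X → Y) (ν : Weighting S (Obs Act Out X)) (p : Act)
    (y : Y) : ν.mapDomain (Obs.map f) (.step p y) =
      weight ν {o | ∃ x', f x' = y ∧ o = .step p x'} := by
  rw [mapDomain_apply_eq_weight]
  congr 1
  ext (_ | _ | _ | _) <;> simp [Obs.map, and_comm]

theorem isHom_of_mapDomain_eq [Semiring S] {β : Trans T Act Out S X} {γ : Trans T Act Out S Y}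
    {f : X → Y} (h : ∀ x α, (β x α).mapDomain (Obs.map f) = γ (f x) α) : IsHom β γ f where
  accept x α := by rw [← h, mapDomain_obsMap_accept]
  reject x α := by rw [← h, mapDomain_obsMap_reject]
  out x α v := by rw [← h, mapDomain_obsMap_out]
  step x α p y := by rw [← h, mapDomain_obsMap_step]

/-- The kernel of `q` is a bisimulation as soon as related states have the same derivatives up
to `q`. -/
theorem isBisimulation_ker [Semiring S] (hpos : IsPositive S) (href : IsRefinement S)
    (β : Trans T Act Out S X) (q : X → Y)
    (hq : ∀ x y, q x = q y →
      ∀ α, (β x α).mapDomain (Obs.map q) = (β y α).mapDomain (Obs.map q)) :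
    IsBisimulation β β {z : X × X | q z.1 = q z.2} := by
  classical
  set R : Set (X × X) := {z | q z.1 = q z.2}
  -- The transition function on the kernel comes from couplings of the derivatives of the two
  -- components.
  choose χ hfst hsnd hχ using fun (z : R) (α : Atom T) =>
    href.exists_coupling hpos (Obs.map q) (β z.1.1 α) (β z.1.2 α) (hq _ _ z.2 α)
  -- Two observations identified by `Obs.map q` have the same kind and label, and their successors,
  -- if any, are related; so the pair is a single observation over `R`.
  have hlift (o : Obs Act Out X × Obs Act Out X) : ∃ o' : Obs Act Out R,
      Obs.map q o.1 = Obs.map q o.2 →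
        Obs.map (fun z : R => z.1.1) o' = o.1 ∧ Obs.map (fun z : R => z.1.2) o' = o.2 := by
    by_cases h : Obs.map q o.1 = Obs.map q o.2
    · obtain ⟨_ | _ | v | ⟨p, x⟩, _ | _ | v' | ⟨p', x'⟩⟩ := o <;>
        simp only [Obs.map, reduceCtorEq, Obs.out.injEq, Obs.step.injEq] at h
      · exact ⟨.accept, fun _ => ⟨rfl, rfl⟩⟩
      · exact ⟨.reject, fun _ => ⟨rfl, rfl⟩⟩
      · exact ⟨.out v, fun _ => ⟨rfl, by rw [← h]; rfl⟩⟩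
      · obtain ⟨rfl, hx⟩ := h
        exact ⟨.step p ⟨(x, x'), hx⟩, fun _ => ⟨rfl, rfl⟩⟩
    -- An arbitrary value: the coupling has no weight on such pairs.
    · exact ⟨.accept, fun h' => absurd h' h⟩
  choose k hk using hlift
  refine ⟨fun z α => (χ z α).mapDomain k, isHom_of_mapDomain_eq fun z α => ?_,
    isHom_of_mapDomain_eq fun z α => ?_⟩
  · rw [← Finsupp.mapDomain_comp, ← hfst z α]
    exact Finsupp.mapDomain_congr fun o ho =>
      (hk o (hχ z α o (Finsupp.mem_support_iff.1 ho))).1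
  · rw [← Finsupp.mapDomain_comp, ← hsnd z α]
    exact Finsupp.mapDomain_congr fun o ho =>
      (hk o (hχ z α o (Finsupp.mem_support_iff.1 ho))).2

end Hom

/-! ### Conway semirings -/

section Conway

variable {S : Type*} [ConwaySemiring S]

theorem star_eq_one_add (a : S) : a∗ = 1 + a * a∗ := by
  have h := ConwaySemiring.star_mul a 1
  rwa [mul_one, one_mul, mul_one] at h

theorem star_zero : (0 : S)∗ = 1 := by
  rw [star_eq_one_add, zero_mul, add_zero]

/-- Apply the sum identity, then unfold `(x * s∗)∗` once. In `L2`, `s` is the weight of the summand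
`1` in the loop body and `x` the remaining weight of immediate acceptance. -/
theorem star_add_eq (s x : S) : (s + x)∗ = s∗ + s∗ * x * (s + x)∗ := by
  rw [ConwaySemiring.star_add]
  conv_lhs => rw [star_eq_one_add (x * s∗)]
  simp only [mul_add, mul_one, mul_assoc]

end Conway

/-! ### Continuations of weightings -/

section Cont

variable {Act Out S X Y Z : Type*} [Semiring S]

/-- Continue an observation: acceptance by `d`, a step by the map `k` on states. -/
noncomputable def Obs.cont (k : X → Y) (d : Weighting S (Obs Act Out Y)) :
    Obs Act Out X → Weighting S (Obs Act Out Y)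
  | .accept => d
  | .reject => dirac .reject
  | .out v => dirac (.out v)
  | .step p x => dirac (.step p (k x))

theorem lin_eq_linearCombination (h : X → Weighting S Y) (φ : Weighting S X) :
    lin h φ = Finsupp.linearCombination S h φ := rfl

theorem lin_add (h : X → Weighting S Y) (φ ψ : Weighting S X) :
    lin h (φ + ψ) = lin h φ + lin h ψ := by
  simp only [lin_eq_linearCombination, map_add]

theorem lin_smul (h : X → Weighting S Y) (r : S) (φ : Weighting S X) :
    lin h (r • φ) = r • lin h φ := by
  simp only [lin_eq_linearCombination, map_smul]

theorem lin_zero (h : X → Weighting S Y) : lin h 0 = 0 := by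
  simp only [lin_eq_linearCombination, map_zero]

theorem lin_dirac (h : X → Weighting S Y) (x : X) : lin h (dirac x) = h x := by
  rw [lin_eq_linearCombination, dirac, Finsupp.linearCombination_single, one_smul]

theorem lin_dirac_comp (f : X → Y) (φ : Weighting S X) :
    lin (fun x => dirac (f x)) φ = φ.mapDomain f := by
  simp [lin, dirac, Finsupp.mapDomain]

theorem lin_mapDomain (h : Y → Weighting S Z) (f : X → Y) (φ : Weighting S X) :
    lin h (φ.mapDomain f) = lin (fun x => h (f x)) φ := by
  rw [lin_eq_linearCombination, Finsupp.linearCombination_mapDomain]; rfl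

theorem lin_lin (g : Y → Weighting S Z) (h : X → Weighting S Y) (φ : Weighting S X) :
    lin g (lin h φ) = lin (fun x => lin g (h x)) φ := by
  induction φ using Finsupp.induction_linear with
  | zero => simp only [lin_zero]
  | add φ ψ hφ hψ => simp only [lin_add, hφ, hψ]
  | single x r =>
    have hr : Finsupp.single x r = r • (dirac x : Weighting S X) := by simp [dirac]
    simp only [hr, lin_smul, lin_dirac]

theorem mapDomain_lin (f : Y → Z) (h : X → Weighting S Y) (φ : Weighting S X) :
    (lin h φ).mapDomain f = lin (fun x => (h x).mapDomain f) φ := by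
  simp only [← lin_dirac_comp f, lin_lin]

theorem mapDomain_dirac (f : X → Y) (x : X) :
    (dirac x : Weighting S X).mapDomain f = dirac (f x) :=
  Finsupp.mapDomain_single

/-- Associativity of sequencing at the level of derivatives, used for `S2` and `F1`. -/
theorem lin_cont_cont (k : X → Y) (l : Y → Z) (d : Weighting S (Obs Act Out Y))
    (d' : Weighting S (Obs Act Out Z)) (φ : Weighting S (Obs Act Out X)) :
    lin (Obs.cont l d') (lin (Obs.cont k d) φ) =
      lin (Obs.cont (fun x => l (k x)) (lin (Obs.cont l d') d)) φ := by
  rw [lin_lin]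
  congr 1
  funext o
  cases o <;> simp only [Obs.cont, lin_dirac]

/-- Only the accepting weight of `φ` meets `d`. Separating it isolates the part that loops rescale
by a star. -/
theorem lin_cont_eq (k : X → Y) (d : Weighting S (Obs Act Out Y))
    (φ : Weighting S (Obs Act Out X)) :
    lin (Obs.cont k d) φ = φ .accept • d + lin (Obs.cont k 0) φ := by
  induction φ using Finsupp.induction_linear with
  | zero => simp only [lin_zero, Finsupp.coe_zero, Pi.zero_apply, zero_smul, add_zero]
  | add φ ψ hφ hψ =>
    rw [lin_add, lin_add, hφ, hψ, Finsupp.add_apply, add_smul]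
    abel
  | single o r =>
    have hr : Finsupp.single o r = r • (dirac o : Weighting S (Obs Act Out X)) := by simp [dirac]
    rw [hr, lin_smul, lin_smul, lin_dirac, lin_dirac]
    cases o <;> simp [Obs.cont, dirac]

theorem lin_cont_id (φ : Weighting S (Obs Act Out X)) :
    lin (Obs.cont id (dirac .accept)) φ = φ := by
  have h : Obs.cont id (dirac .accept) = fun o : Obs Act Out X => (dirac o : Weighting S _) := by
    funext o
    cases o <;> rfl
  rw [h, lin_dirac_comp (fun o => o)]
  exact Finsupp.mapDomain_id

theorem lin_cont_zero_accept (k : X → Y) (φ : Weighting S (Obs Act Out X)) :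
    lin (Obs.cont k 0) φ .accept = 0 := by
  rw [lin, Finsupp.sum, Finsupp.finsetSum_apply]
  refine Finset.sum_eq_zero fun o _ => ?_
  cases o <;> simp [Obs.cont, dirac]

end Cont

/-! ### Derivatives up to provable equivalence -/

section Soundness

variable {T Act Out S : Type*} [ConwaySemiring S]

theorem Atom.entails_and_iff (α : Atom T) (b c : BExp T) :
    α.Entails (.and b c) ↔ α.Entails b ∧ α.Entails c := by
  obtain ⟨⟨a⟩, ha⟩ := α
  have hle (c : BExp T) : Atom.Entails ⟨Quot.mk _ a, ha⟩ c ↔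
      ∀ v : T → Bool, a.eval v = true → c.eval v = true := baLe_iff a c
  simp only [hle, BExp.eval, Bool.and_eq_true, ← forall_and]

theorem Atom.entails_one (α : Atom T) : α.Entails .one := by
  obtain ⟨⟨a⟩, ha⟩ := α
  exact (baLe_iff a .one).2 fun _ _ => rfl

theorem Atom.not_entails_zero (α : Atom T) : ¬ α.Entails .zero := fun h =>
  α.2.1 (le_bot_iff.1 h)

theorem Atom.entails_congr (α : Atom T) {b c : BExp T} (h : BAEquiv b c) :
    α.Entails b ↔ α.Entails c := by
  have hbc : BQuot.mk b = BQuot.mk c := Quotient.sound h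
  rw [Atom.Entails, Atom.Entails, hbc]

theorem seqCont_eq_cont (f : Exp T Act Out S)
    (d : Weighting S (Obs Act Out (Exp T Act Out S))) :
    seqCont f d = Obs.cont (fun e => .seq e f) d := by
  funext o
  cases o <;> rfl

/-- Connects the syntactic side condition of `F1` with the operational semantics. -/
theorem deriv_accept_eq_E (e : Exp T Act Out S) (α : Atom T) : deriv e α .accept = E e α := by
  classical
  induction e with
  | act p => simp [deriv, E, dirac]
  | test b => rw [deriv, E]; split_ifs <;> simp [dirac]
  | ite b e f he hf => rw [deriv, E]; split_ifs <;> assumption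
  | seq e f he hf =>
    rw [deriv, E, seqCont_eq_cont, lin_cont_eq, Finsupp.add_apply, lin_cont_zero_accept,
      Finsupp.smul_apply, he, hf, add_zero, smul_eq_mul]
  | loop b e he =>
    rw [E]
    split_ifs with h
    · rw [deriv_loop_not b e α h, dirac, Finsupp.single_eq_same]
    · exact deriv_loop_accept b e α (not_not.1 (mt (α.entails_not_iff b).2 h))
  | out v => simp [deriv, E, dirac]
  | choice r s e f he hf => simp [deriv, E, he, hf]

/-- Provable equivalence as a setoid. -/
def provableSetoid (T Act Out S : Type*) [ConwaySemiring S] : Setoid (Exp T Act Out S) where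
  r := Provable
  iseqv := ⟨.refl, .symm, .trans⟩

/-- Expressions up to provable equivalence. -/
def ExpQuot (T Act Out S : Type*) [ConwaySemiring S] : Type _ :=
  Quotient (provableSetoid T Act Out S)

/-- The class of an expression. -/
def ExpQuot.mk (e : Exp T Act Out S) : ExpQuot T Act Out S :=
  Quotient.mk (provableSetoid T Act Out S) e

theorem ExpQuot.mk_eq_mk {e f : Exp T Act Out S} : ExpQuot.mk e = ExpQuot.mk f ↔ Provable e f :=
  Quotient.eq (r := provableSetoid T Act Out S)

/-- Sequencing of classes. -/
def ExpQuot.seq : ExpQuot T Act Out S → ExpQuot T Act Out S → ExpQuot T Act Out S :=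
  Quotient.map₂ Exp.seq fun _ _ h _ _ k => .congr_seq h k

theorem ExpQuot.mk_seq (e f : Exp T Act Out S) :
    ExpQuot.mk (.seq e f) = (ExpQuot.mk e).seq (ExpQuot.mk f) := rfl

theorem ExpQuot.seq_one (x : ExpQuot T Act Out S) : x.seq (.mk .one) = x := by
  obtain ⟨e⟩ := x
  exact ExpQuot.mk_eq_mk.2 (Provable.S1_right e).symm

theorem ExpQuot.seq_assoc (x y z : ExpQuot T Act Out S) :
    (x.seq y).seq z = x.seq (y.seq z) := by
  obtain ⟨e⟩ := x
  obtain ⟨f⟩ := y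
  obtain ⟨g⟩ := z
  exact ExpQuot.mk_eq_mk.2 (.S2 e f g)

/-- The derivative with the next states taken up to provable equivalence. -/
noncomputable def quotDeriv (e : Exp T Act Out S) (α : Atom T) :
    Weighting S (Obs Act Out (ExpQuot T Act Out S)) :=
  (deriv e α).mapDomain (Obs.map ExpQuot.mk)

/-! ### Derivatives modulo provable equivalence, by constructor -/

theorem quotDeriv_accept (e : Exp T Act Out S) (α : Atom T) :
    quotDeriv e α .accept = deriv e α .accept :=
  mapDomain_obsMap_accept _ _

open Classical in
theorem quotDeriv_test (b : BExp T) (α : Atom T) :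
    quotDeriv (.test b : Exp T Act Out S) α =
      if α.Entails b then dirac .accept else dirac .reject := by
  rw [quotDeriv, deriv]
  split_ifs <;> exact mapDomain_dirac _ _

theorem quotDeriv_one (α : Atom T) :
    quotDeriv (.one : Exp T Act Out S) α = dirac .accept := by
  rw [Exp.one, quotDeriv_test, if_pos α.entails_one]

theorem quotDeriv_zero (α : Atom T) :
    quotDeriv (.zero : Exp T Act Out S) α = dirac .reject := by
  rw [Exp.zero, quotDeriv_test, if_neg α.not_entails_zero]

theorem quotDeriv_out (v : Out) (α : Atom T) :
    quotDeriv (.out v : Exp T Act Out S) α = dirac (.out v) := by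
  rw [quotDeriv, deriv]
  exact mapDomain_dirac _ _

open Classical in
theorem quotDeriv_ite (b : BExp T) (e f : Exp T Act Out S) (α : Atom T) :
    quotDeriv (.ite b e f) α = if α.Entails b then quotDeriv e α else quotDeriv f α := by
  rw [quotDeriv, deriv]
  split_ifs <;> rfl

theorem quotDeriv_choice (r s : S) (e f : Exp T Act Out S) (α : Atom T) :
    quotDeriv (.choice r s e f) α = r • quotDeriv e α + s • quotDeriv f α := by
  rw [quotDeriv, deriv, Finsupp.mapDomain_add, Finsupp.mapDomain_smul, Finsupp.mapDomain_smul]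
  rfl

theorem quotDeriv_scale (r : S) (α : Atom T) :
    quotDeriv (.scale r : Exp T Act Out S) α = r • dirac .accept := by
  rw [Exp.scale, quotDeriv_choice, quotDeriv_one, zero_smul, add_zero]

/-- Sequencing respects provable equivalence, so continuing by `f` commutes with passing to classes.
-/
theorem mapDomain_lin_seqCont (f : Exp T Act Out S)
    (d φ : Weighting S (Obs Act Out (Exp T Act Out S))) :
    (lin (seqCont f d) φ).mapDomain (Obs.map ExpQuot.mk) =
      lin (Obs.cont (fun x => x.seq (.mk f)) (d.mapDomain (Obs.map ExpQuot.mk)))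
        (φ.mapDomain (Obs.map ExpQuot.mk)) := by
  rw [mapDomain_lin, lin_mapDomain]
  congr 1
  funext o
  cases o <;> simp only [seqCont, mapDomain_dirac, Obs.map, Obs.cont, ExpQuot.mk_seq]

theorem quotDeriv_seq (e f : Exp T Act Out S) (α : Atom T) :
    quotDeriv (.seq e f) α =
      lin (Obs.cont (fun x => x.seq (.mk f)) (quotDeriv f α)) (quotDeriv e α) := by
  rw [quotDeriv, deriv, mapDomain_lin_seqCont]
  rfl

open Classical in
theorem quotDeriv_test_seq (b : BExp T) (e : Exp T Act Out S) (α : Atom T) :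
    quotDeriv (.seq (.test b) e) α = if α.Entails b then quotDeriv e α else dirac .reject := by
  rw [quotDeriv_seq, quotDeriv_test]
  split_ifs <;> exact lin_dirac _ _

theorem quotDeriv_scale_seq (r : S) (e : Exp T Act Out S) (α : Atom T) :
    quotDeriv (.seq (.scale r) e) α = r • quotDeriv e α := by
  rw [quotDeriv_seq, quotDeriv_scale, lin_smul, lin_dirac]
  rfl

open Classical in
theorem quotDeriv_loop (b : BExp T) (e : Exp T Act Out S) (α : Atom T) :
    quotDeriv (.loop b e) α =
      if α.Entails b then
        (quotDeriv e α .accept)∗ •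
          lin (Obs.cont (fun x => x.seq (.mk (.loop b e))) 0) (quotDeriv e α)
      else dirac .accept := by
  rw [quotDeriv_accept, quotDeriv, deriv]
  split_ifs
  · rw [Finsupp.mapDomain_smul, mapDomain_lin_seqCont, Finsupp.mapDomain_zero]
    rfl
  · exact mapDomain_dirac _ _

/-- This makes `quotDeriv` a transition function on classes. The congruence rules for sequencing and
loops use the premise or conclusion of the rule, beside the induction hypotheses, to identify
successors. -/
theorem Provable.quotDeriv_eq {e f : Exp T Act Out S} (h : Provable e f) (α : Atom T) :
    quotDeriv e α = quotDeriv f α := by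
  classical
  induction h with
  | refl e => rfl
  | symm _ ih => exact ih.symm
  | trans _ _ ih₁ ih₂ => exact ih₁.trans ih₂
  | congr_ite hbc _ _ ihe ihf =>
    simp only [quotDeriv_ite, α.entails_congr hbc, ihe, ihf]
  | congr_seq _ hf ihe ihf =>
    rw [quotDeriv_seq, quotDeriv_seq, ihe, ihf, ExpQuot.mk_eq_mk.2 hf]
  | congr_loop hbc he ih =>
    simp only [quotDeriv_loop, α.entails_congr hbc, ih,
      ExpQuot.mk_eq_mk.2 (Provable.congr_loop hbc he)]
  | congr_choice r s _ _ ihe ihf => rw [quotDeriv_choice, quotDeriv_choice, ihe, ihf]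
  | ba hbc => simp only [quotDeriv_test, α.entails_congr hbc]
  | G1 b e => rw [quotDeriv_ite, ite_self]
  | G2 b e f =>
    simp only [quotDeriv_ite, quotDeriv_test_seq]
    split_ifs <;> rfl
  | G3 b e f =>
    simp only [quotDeriv_ite, α.entails_not_iff, ite_not]
  | G4 b c e f g =>
    simp only [quotDeriv_ite, α.entails_and_iff]
    by_cases hb : α.Entails b <;> by_cases hc : α.Entails c <;> simp [hb, hc]
  | D1 r s b e f g =>
    simp only [quotDeriv_ite, quotDeriv_choice]
    split_ifs <;> rfl
  | D2 r s t u e f g =>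
    simp only [quotDeriv_choice, smul_add, smul_smul, one_mul]
  | D3 r s b e f =>
    simp only [quotDeriv_test_seq, quotDeriv_choice]
    split_ifs <;> rfl
  | S1_left e => rw [Exp.one, quotDeriv_test_seq, if_pos α.entails_one]
  | S1_right e =>
    simp only [quotDeriv_seq, quotDeriv_one, ExpQuot.seq_one]
    exact (lin_cont_id _).symm
  | S2 e f g =>
    simp only [quotDeriv_seq, lin_cont_cont, ExpQuot.seq_assoc, ExpQuot.mk_seq]
  | S3 e =>
    rw [quotDeriv_zero, Exp.zero, quotDeriv_test_seq, if_neg α.not_entails_zero]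
  | S4 r s e f g => simp only [quotDeriv_seq, quotDeriv_choice, lin_add, lin_smul]
  | S5 b e f g =>
    simp only [quotDeriv_seq, quotDeriv_ite]
    split_ifs <;> rfl
  | S6 v e =>
    rw [quotDeriv_seq, quotDeriv_out, lin_dirac]
    rfl
  | S7 b c =>
    simp only [quotDeriv_test_seq, quotDeriv_test, α.entails_and_iff]
    by_cases hb : α.Entails b <;> by_cases hc : α.Entails c <;> simp [hb, hc]
  | L1 b e =>
    rw [quotDeriv_ite, quotDeriv_seq, quotDeriv_one, lin_cont_eq, quotDeriv_loop]
    split_ifs with hb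
    -- In `1 + a * a∗`, the `1` gives the steps of the first iteration and `a * a∗` those after the
    -- body accepts with weight `a`.
    · conv_lhs => rw [star_eq_one_add]
      rw [add_smul, one_smul, smul_smul, add_comm]
    · rfl
  | L2 r s b c e f g _ ih =>
    rw [quotDeriv_test_seq, quotDeriv_test_seq]
    split_ifs with hc
    · rw [quotDeriv_ite, quotDeriv_scale_seq, quotDeriv_seq, quotDeriv_one, lin_cont_eq]
      rw [quotDeriv_ite, if_pos hc, quotDeriv_choice, quotDeriv_one] at ih
      rw [quotDeriv_loop]
      split_ifs with hb
      · have hacc : quotDeriv e α .accept = s + r * quotDeriv f α .accept := by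
          rw [ih, add_comm]
          simp [dirac]
        -- The summand `1` of the body only accepts, so it contributes nothing to the steps and
        -- outcomes other than acceptance.
        have hlin (k : ExpQuot T Act Out S → ExpQuot T Act Out S) :
            lin (Obs.cont k 0) (quotDeriv e α) = r • lin (Obs.cont k 0) (quotDeriv f α) := by
          rw [ih, lin_add, lin_smul, lin_smul, lin_dirac, Obs.cont, smul_zero, add_zero]
        rw [hacc, hlin]
        conv_lhs => rw [star_add_eq]
        simp only [smul_add, smul_smul, mul_assoc, add_mul]
        rw [add_comm, add_smul]
      · rfl
    · rfl
  | C1 => rw [quotDeriv_scale, quotDeriv_one, one_smul]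
  | C2 e => rw [quotDeriv_scale_seq, quotDeriv_scale, zero_smul, zero_smul]
  | W1 r s e => rw [quotDeriv_choice, quotDeriv_scale_seq, add_smul]
  | W2 r s e f => rw [quotDeriv_choice, quotDeriv_choice, add_comm]
  | W3 r s t u e f g =>
    simp only [quotDeriv_choice, smul_add, smul_smul, one_mul, add_assoc]
  | W4 r s u e f => simp only [quotDeriv_choice, quotDeriv_scale_seq, smul_smul]
  | F1 b e f g hg hE ih =>
    -- The conclusion of the rule is available as an equality of classes, and identifies successors
    -- `e';g` with `e';(e^(b);f)`.
    have hmk := ExpQuot.mk_eq_mk.2 (Provable.F1 b e f g hg hE)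
    rw [ih, quotDeriv_ite, quotDeriv_seq, quotDeriv_seq, quotDeriv_loop]
    split_ifs with hb
    -- As `e` accepts with weight 0, the loop factor is `0∗ = 1`, and the derivatives of the
    -- continuations drop out on both sides.
    · rw [quotDeriv_accept, deriv_accept_eq_E, hE, star_zero, one_smul, lin_cont_cont,
        lin_cont_eq, lin_cont_eq (d := lin _ 0), quotDeriv_accept, deriv_accept_eq_E, hE,
        zero_smul, zero_smul, hmk]
      simp only [ExpQuot.mk_seq, ExpQuot.seq_assoc]
    · rw [lin_dirac]
      rfl

end Soundness

end WGKAT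

theorem mainTheorem2 {T Act Out S : Type*} [Finite T] [WGKAT.ConwaySemiring S] [Nontrivial S]
    (hpos : WGKAT.IsPositive S) (href : WGKAT.IsRefinement S)
    (e f : WGKAT.Exp T Act Out S) (h : WGKAT.Provable e f) :
    WGKAT.Bisimilar WGKAT.deriv WGKAT.deriv e f :=
  ⟨_, WGKAT.isBisimulation_ker hpos href WGKAT.deriv WGKAT.ExpQuot.mk
    fun _ _ hxy α => (WGKAT.ExpQuot.mk_eq_mk.1 hxy).quotDeriv_eq α, WGKAT.ExpQuot.mk_eq_mk.2 h⟩
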